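/- **Paging model.** A cache holds at most $k$ pages. A request sequence $\sigma$ is served by choosing, for each request, a cache content that contains the requested page, and a cache content to be kept until the next request; bringing a page into the cache costs $1$. Let $\mathrm{OPT}(\sigma)$ be the least cost of an offline schedule serving $\sigma$, let $\mathrm{LRU}$ be Least-Recently-Used, and let $\mathrm{PLFU}$ be Perfect LFU: it keeps the $k$ most popular pages in the cache, and at a page fault it evicts the $k$-th most popular page to make room for the requested page and brings it back right after the request (so a page fault costs $2$). All algorithms start from the same initial cache content, with at most $k$ pages. When each request is drawn independently from a distribution $p$ on the pages, and $\mathbb{E}^n$ denotes the expectation over a sequence of $n$ requests, let $$\mathrm{RoE}(\mathrm{ALG})=\limsup_{n\to\infty}\frac{\mathbb{E}^n[\mathrm{ALG}(\sigma)]}{\mathbb{E}^n[\mathrm{OPT}(\sigma)]}.$$ **Theorem.** There is an absolute constant $c>0$ such that the following holds for every $k\ge 2$, for the $k+1$ pages with probabilities $p_1=\dots=p_k=\frac{1-\varepsilon}{k}$ and $p_{k+1}=\varepsilon=\frac1{k^3}$, for every initial cache content (for LRU also with any initial recency order of these pages), and however ties among the most popular pages are broken in PLFU: 1. $\mathrm{RoE}(\mathrm{LRU})\ge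 c\log k$, i.e. $\mathrm{RoE}(\mathrm{LRU})=\Omega(\log k)$; more precisely, $\mathrm{RoE}(\mathrm{LRU})\ge \frac12 H_{k-1}$, where $H_{j}=\sum_{i=1}^{j}\frac1i$; 2. $\mathrm{RoE}(\mathrm{PLFU})<4$; 3. consequently LRU is $\Omega(\log k)$ times worse than PLFU: $\mathrm{RoE}(\mathrm{LRU})\ge c\log k\cdot\mathrm{RoE}(\mathrm{PLFU})$. -/

import Mathlib

namespace Paging

/-- A schedule serving a request sequence: for every request, the cache `D` in which the request
is served and the cache `C` that is kept afterwards (until the next request). -/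
abbrev Schedule (α : Type*) := List (Finset α × Finset α)

/-- The schedule `s` serves the request sequence `σ` with a cache of size `k`: at every request,
the requested page lies in the serving cache, and no cache holds more than `k` pages. -/
def Serves {α : Type*} (k : ℕ) (σ : List α) (s : Schedule α) : Prop :=
  List.Forall₂ (fun r DC => r ∈ DC.1 ∧ DC.1.card ≤ k ∧ DC.2.card ≤ k) σ s

/-- The cost of a schedule from the cache `C₀`: every page brought into the cache costs `1`. -/
def Schedule.cost {α : Type*} [DecidableEq α] : Finset α → Schedule α → ℕ
  | _, [] => 0
  | C₀, (D, C) :: s => (D \ C₀).card + (C \ D).card + Schedule.cost C s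

/-- The cost of the offline optimum: the least cost of a schedule that serves `σ` with a cache of
size `k`, starting from the cache `C₀`. -/
noncomputable def opt {α : Type*} [DecidableEq α] (k : ℕ) (C₀ : Finset α) (σ : List α) : ℕ :=
  sInf {c | ∃ s : Schedule α, Serves k σ s ∧ s.cost C₀ = c}

/-- The schedule of Least-Recently-Used. The list `L` is the cache, the most recently requested
page first: the requested page moves to the front, and at a page fault with a full cache the last
page of the list is evicted. -/
def lruSchedule {α : Type*} [DecidableEq α] (k : ℕ) : List α → List α → Schedule α
  | _, [] => []
  | L, r :: σ =>
    let L' := (r :: L.erase r).take k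
    (L'.toFinset, L'.toFinset) :: lruSchedule k L' σ

/-- The cost of LRU when the initial cache is `L`, most recently used page first. -/
def lru {α : Type*} [DecidableEq α] (k : ℕ) (L : List α) (σ : List α) : ℕ :=
  (lruSchedule k L σ).cost L.toFinset

/-- `T` is a set of `k` most popular pages under the page probabilities `p`, and `w` is a least
popular page of `T`, that is, the `k`-th most popular page. -/
structure IsMostPopular {α : Type*} (p : α → ℝ) (k : ℕ) (T : Finset α) (w : α) : Prop where
  card_eq : T.card = k
  mem : w ∈ T
  le_of_mem : ∀ i ∈ T, p w ≤ p i
  le_of_notMem : ∀ j ∉ T, p j ≤ p w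

/-- The schedule of Perfect LFU: the cache is the set `T` of the `k` most popular pages; at a page
fault the `k`-th most popular page `w` is evicted to make room for the requested page, and right
after the request `w` is brought back in place of the requested page. -/
def plfuSchedule {α : Type*} [DecidableEq α] (T : Finset α) (w : α) (σ : List α) : Schedule α :=
  σ.map fun r => if r ∈ T then (T, T) else (insert r (T.erase w), T)

/-- The cost of PLFU from the initial cache `C₀` (the pages of `T` that are missing from `C₀` are
paid for as well). -/
def plfu {α : Type*} [DecidableEq α] (T : Finset α) (w : α) (C₀ : Finset α) (σ : List α) : ℕ :=
  (plfuSchedule T w σ).cost C₀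

/-- The expectation of `f` over a sequence of `n` requests drawn independently from `p`. -/
noncomputable def expect {α : Type*} [Fintype α] (p : α → ℝ) (n : ℕ) (f : List α → ℕ) : ℝ :=
  ∑ σ : Fin n → α, (∏ t, p (σ t)) * (f (List.ofFn σ) : ℝ)

/-- The ratio of expectations of an algorithm with cost function `alg`, for a cache of size `k`
that initially holds `C₀`: the upper limit, as the number `n` of requests tends to infinity, of
the expected cost of the algorithm divided by the expected cost of the offline optimum. -/
noncomputable def RoE {α : Type*} [Fintype α] [DecidableEq α] (p : α → ℝ) (k : ℕ) (C₀ : Finset α)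
    (alg : List α → ℕ) : EReal :=
  Filter.limsup (fun n : ℕ => ((expect p n alg / expect p n (opt k C₀) : ℝ) : EReal)) Filter.atTop

/-- The page probabilities of the instance: `k` big pages of probability `(1 - ε) / k` each and one
small page (the last one) of probability `ε`, where `ε = 1 / k ^ 3`. -/
noncomputable def prob (k : ℕ) (i : Fin (k + 1)) : ℝ :=
  if i = Fin.last k then 1 / (k : ℝ) ^ 3 else (1 - 1 / (k : ℝ) ^ 3) / k

theorem sum_prob {k : ℕ} (hk : 1 ≤ k) : ∑ i, prob k i = 1 := by
  have h : (k : ℝ) ≠ 0 := by positivity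
  rw [Fin.sum_univ_castSucc]
  simp [prob, Fin.castSucc_ne_last]
  field_simp
  ring

theorem small_lt_big {k : ℕ} (hk : 2 ≤ k) :
    0 < 1 / (k : ℝ) ^ 3 ∧ 1 / (k : ℝ) ^ 3 < (1 - 1 / (k : ℝ) ^ 3) / k := by
  have h : (2 : ℝ) ≤ k := by exact_mod_cast hk
  refine ⟨by positivity, ?_⟩
  rw [lt_div_iff₀ (by positivity), lt_sub_iff_add_lt, div_mul_eq_mul_div, ← add_div,
    div_lt_one (by positivity)]
  nlinarith [mul_self_nonneg ((k : ℝ) - 1), mul_le_mul h h (by norm_num) (by linarith)]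

theorem prob_pos {k : ℕ} (hk : 2 ≤ k) (i : Fin (k + 1)) : 0 < prob k i := by
  have := small_lt_big hk
  unfold prob
  split_ifs <;> linarith

theorem exists_isMostPopular {k : ℕ} (hk : 2 ≤ k) : ∃ T w, IsMostPopular (prob k) k T w := by
  have h := small_lt_big hk
  have h0 : (0 : Fin (k + 1)) ≠ Fin.last k := by
    intro h0
    have := congrArg Fin.val h0
    simp at this
    omega
  refine ⟨Finset.univ.erase (Fin.last k), 0, ⟨by simp, by simpa using h0, ?_, ?_⟩⟩
  · intro i hi
    have hi' : i ≠ Fin.last k := by simpa using hi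
    simp [prob, h0, hi']
  · intro j hj
    have hj' : j = Fin.last k := by simpa using hj
    subst hj'
    simpa [prob, h0] using h.2.le

theorem lruSchedule_serves {α : Type*} [DecidableEq α] {k : ℕ} (hk : 1 ≤ k) (L σ : List α) :
    Serves k σ (lruSchedule k L σ) := by
  induction σ generalizing L with
  | nil => exact List.Forall₂.nil
  | cons r σ ih =>
    have hc : ((r :: L.erase r).take k).toFinset.card ≤ k :=
      (List.toFinset_card_le _).trans (List.length_take_le _ _)
    refine List.Forall₂.cons ⟨?_, hc, hc⟩ (ih _)
    obtain ⟨k, rfl⟩ := Nat.exists_eq_add_of_le' hk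
    simp

theorem plfuSchedule_serves {α : Type*} [DecidableEq α] {p : α → ℝ} {k : ℕ} {T : Finset α} {w : α}
    (h : IsMostPopular p k T w) (σ : List α) : Serves k σ (plfuSchedule T w σ) := by
  induction σ with
  | nil => exact List.Forall₂.nil
  | cons r σ ih =>
    refine List.Forall₂.cons ?_ ih
    have hT := h.card_eq
    have hw := Finset.card_erase_add_one h.mem
    have := Finset.card_insert_le r (T.erase w)
    dsimp only
    split_ifs with hr
    · exact ⟨hr, hT.le, hT.le⟩
    · exact ⟨Finset.mem_insert_self _ _, by dsimp only; omega, hT.le⟩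

end Paging

namespace Paging

open Finset

/-! Write `ε` for the probability of the small page `s` and `β` for that of a big page. OPT: every
stretch of requests containing all `k + 1` pages forces at least one fetch. Such a stretch has
expected length at most `1/ε + H_k/β`, by waiting for `s` and then collecting the big pages. Hence
OPT has rate at least `1/(1/ε + H_k/β)`, nearly `ε`; PLFU itself shows that the rate is at most
`2ε`. PLFU pays 2 exactly when `s` is requested, so its ratio is at most `2 + 2kH_k/(k^3 - 1) < 4`.
LRU: a request to `s` keeps `s` in the cache until it has slid to the end, while some big page is
missing. With `j` pages not in front of `s`, it slides one place with probability `jβ`, so it stays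
for about `H_k/β` steps, each faulting with probability `β`. Each request to `s` thus causes about
`H_k` faults; `lru_drift` turns this into a potential argument with rate `εH_{k-1}`, and dividing by
`2ε` gives `H_{k-1}/2`. -/

/-! ### Expectations over i.i.d. requests and the potential method -/

theorem expect_zero {α : Type*} [Fintype α] (p : α → ℝ) (f : List α → ℕ) :
    expect p 0 f = f [] := by
  simp [expect]

theorem expect_succ {α : Type*} [Fintype α] (p : α → ℝ) (n : ℕ) (f : List α → ℕ) :
    expect p (n + 1) f = ∑ a, p a * expect p n fun σ => f (a :: σ) := by
  unfold expect
  rw [← (Fin.consEquiv fun _ : Fin (n + 1) => α).sum_comp, Fintype.sum_prod_type]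
  refine Finset.sum_congr rfl fun a _ => ?_
  rw [Finset.mul_sum]
  refine Finset.sum_congr rfl fun σ _ => ?_
  simp [Fin.consEquiv, Fin.prod_univ_succ, List.ofFn_succ, mul_assoc]

theorem expect_mono {α : Type*} [Fintype α] {p : α → ℝ} (hp : ∀ a, 0 ≤ p a) (n : ℕ)
    {f g : List α → ℕ} (h : ∀ σ, f σ ≤ g σ) : expect p n f ≤ expect p n g :=
  Finset.sum_le_sum fun σ _ => mul_le_mul_of_nonneg_left (by exact_mod_cast h _)
    (Finset.prod_nonneg fun _ _ => hp _)

theorem expect_nonneg {α : Type*} [Fintype α] {p : α → ℝ} (hp : ∀ a, 0 ≤ p a) (n : ℕ)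
    (f : List α → ℕ) : 0 ≤ expect p n f :=
  Finset.sum_nonneg fun _ _ =>
    mul_nonneg (Finset.prod_nonneg fun _ _ => hp _) (Nat.cast_nonneg _)

theorem expect_const_add {α : Type*} [Fintype α] {p : α → ℝ} (hp1 : ∑ a, p a = 1) (n N : ℕ)
    (f : List α → ℕ) : expect p n (fun σ => N + f σ) = N + expect p n f := by
  induction n generalizing f with
  | zero => simp [expect_zero]
  | succ n ih =>
    simp only [expect_succ, ih, mul_add, Finset.sum_add_distrib, ← Finset.sum_mul, hp1, one_mul]

/-- The potential function method: if on average the cost of a step plus the change of the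
potential is at least `ρ`, then the expected cost of `n` steps is at least `n * ρ`, up to the
range of the potential. -/
theorem le_expect_of_potential {α X : Type*} [Fintype α] {p : α → ℝ} (hp : ∀ a, 0 ≤ p a)
    (hp1 : ∑ a, p a = 1) (F : X → List α → ℕ) (c : X → α → ℕ) (step : X → α → X)
    (hF : ∀ x a σ, F x (a :: σ) = c x a + F (step x a) σ) (I : X → Prop)
    (hI : ∀ x a, I x → I (step x a)) (Φ : X → ℝ) {M ρ : ℝ} (hM : ∀ x, Φ x ≤ M)
    (hΦ : ∀ x, I x → Φ x + ρ ≤ ∑ a, p a * (c x a + Φ (step x a))) (n : ℕ) (x : X) (hx : I x) :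
    n * ρ + Φ x - M ≤ expect p n (F x) := by
  induction n generalizing x with
  | zero =>
    rw [expect_zero]
    have := hM x
    have : (0 : ℝ) ≤ F x [] := by positivity
    push_cast
    linarith
  | succ n ih =>
    rw [expect_succ]
    have h : ∀ a, p a * (c x a + Φ (step x a)) + p a * (n * ρ - M) ≤
        p a * expect p n (fun σ => F x (a :: σ)) := by
      intro a
      rw [← mul_add]
      refine mul_le_mul_of_nonneg_left ?_ (hp a)
      simp only [hF, expect_const_add hp1]
      linarith [ih (step x a) (hI x a hx)]
    have h2 := Finset.sum_le_sum fun a (_ : a ∈ (Finset.univ : Finset α)) => h a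
    rw [Finset.sum_add_distrib, ← Finset.sum_mul, hp1] at h2
    have := hΦ x hx
    push_cast
    linarith

/-! ### Lower bound on OPT by segments containing all pages -/

/-- The number of disjoint consecutive segments of the request sequence that contain all pages;
`S` is the set of the pages already seen in the current segment. -/
def segments {α : Type*} [Fintype α] [DecidableEq α] : Finset α → List α → ℕ
  | _, [] => 0
  | S, r :: σ =>
    (if insert r S = univ then 1 else 0) +
      segments (if insert r S = univ then ∅ else insert r S) σ

/-- The last summand is a debt that can only arise at a paid step: a free step never enlarges `S ∪
C`. A segment completed by a free step has `S ∪ C` already too large for one cache, so the debt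
settles it, and the next segment starts without debt. -/
theorem segments_le_cost {α : Type*} [Fintype α] [DecidableEq α] {k : ℕ}
    (hk : k < Fintype.card α) {σ : List α} {s : Schedule α} (h : Serves k σ s) (S C : Finset α) :
    segments S σ ≤ s.cost C + if (S ∪ C).card ≤ k then 0 else 1 := by
  induction h generalizing S C with
  | nil => simp [segments]
  | @cons r DC σ s h _ ih =>
    obtain ⟨D, E⟩ := DC
    obtain ⟨hr, -, hE⟩ := h
    simp only [segments, Schedule.cost]
    simp only at hr hE
    have hsub : (D \ C).card + (E \ D).card = 0 → insert r S ∪ E ⊆ S ∪ C := by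
      intro h0
      rw [Nat.add_eq_zero_iff, card_eq_zero, card_eq_zero, sdiff_eq_empty_iff_subset,
        sdiff_eq_empty_iff_subset] at h0
      intro x hx
      simp only [mem_union, mem_insert] at hx ⊢
      rcases hx with (rfl | hx) | hx
      · exact Or.inr (h0.1 hr)
      · exact Or.inl hx
      · exact Or.inr (h0.1 (h0.2 hx))
    by_cases hu : insert r S = univ
    · simp only [if_pos hu]
      have h1 := ih ∅ E
      rw [empty_union, if_pos hE] at h1
      have h2 : (D \ C).card + (E \ D).card = 0 → ¬ (S ∪ C).card ≤ k := by
        intro h0 hle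
        have := card_le_card (subset_union_left.trans (hsub h0))
        rw [hu, card_univ] at this
        omega
      split_ifs <;> omega
    · simp only [if_neg hu]
      have h1 := ih (insert r S) E
      have h2 : (D \ C).card + (E \ D).card = 0 → (insert r S ∪ E).card ≤ (S ∪ C).card :=
        fun h0 => card_le_card (hsub h0)
      split_ifs at h1 ⊢ <;> omega

theorem segments_le_opt {α : Type*} [Fintype α] [DecidableEq α] {k : ℕ}
    (hk : k < Fintype.card α) {C : Finset α} (hC : C.card ≤ k) {σ : List α}
    (hs : ∃ s, Serves k σ s) : segments ∅ σ ≤ opt k C σ := by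
  obtain ⟨s, hs⟩ := hs
  -- Nonemptiness matters: `sInf ∅ = 0` in `ℕ`.
  refine le_csInf ⟨_, s, hs, rfl⟩ ?_
  rintro _ ⟨s, hs, rfl⟩
  simpa [hC] using segments_le_cost hk hs ∅ C

theorem opt_le_cost {α : Type*} [DecidableEq α] {k : ℕ} (C : Finset α) {σ : List α}
    {s : Schedule α} (hs : Serves k σ s) : opt k C σ ≤ s.cost C :=
  Nat.sInf_le ⟨s, hs, rfl⟩

/-! ### Coupon collecting: expected length of a segment -/

/-- The expected time, up to a bounded error, until all pages have been requested, if the pages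
of `S` already have been. -/
noncomputable def collectTime {α : Type*} [Fintype α] [DecidableEq α] (s : α) (ε β : ℝ)
    (S : Finset α) : ℝ :=
  (if s ∈ S then 0 else 1 / ε) + (harmonic (Sᶜ.erase s).card : ℝ) / β

theorem harmonic_nonneg (n : ℕ) : 0 ≤ (harmonic n : ℝ) := by
  rw [harmonic]
  push_cast
  positivity

theorem harmonic_succ_real (n : ℕ) :
    (harmonic (n + 1) : ℝ) = harmonic n + 1 / ((n : ℝ) + 1) := by
  rw [harmonic_succ]
  push_cast
  rw [one_div]

theorem harmonic_mono_real : Monotone fun n => (harmonic n : ℝ) := by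
  refine monotone_nat_of_le_succ fun n => ?_
  rw [harmonic_succ_real]
  have : 0 ≤ 1 / ((n : ℝ) + 1) := by positivity
  linarith

theorem harmonic_le_self (n : ℕ) : (harmonic n : ℝ) ≤ n := by
  induction n with
  | zero => simp
  | succ n ih =>
    rw [harmonic_succ_real]
    have : 1 / ((n : ℝ) + 1) ≤ 1 := by
      rw [div_le_one (by positivity)]
      linarith [(n.cast_nonneg : (0 : ℝ) ≤ n)]
    push_cast
    linarith

section

variable {α : Type*} [Fintype α] [DecidableEq α] {s : α} {p : α → ℝ} {ε β : ℝ}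

/-- While `s` is unseen, only its request is credited: probability `ε`, gain `1/ε`. Once `s` is
seen, each of the `j + 1` unseen pages has probability `β` and gains `1/((j + 1)β)`. Either way the
expected gain is at least 1. -/
theorem sum_mul_collectTime_insert_le (hε : 0 < ε) (hβ : 0 < β) (hs : p s = ε)
    (hb : ∀ r, r ≠ s → p r = β) (hp1 : ∑ a, p a = 1) {S : Finset α} (hS : S ≠ univ) :
    ∑ r, p r * collectTime s ε β (insert r S) ≤ collectTime s ε β S - 1 := by
  have hp : ∀ r, 0 ≤ p r := fun r => by
    by_cases h : r = s
    · rw [h, hs]; exact hε.le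
    · rw [hb r h]; exact hβ.le
  suffices h : ∃ d : α → ℝ, (∀ r, collectTime s ε β (insert r S) ≤ collectTime s ε β S - d r) ∧
      1 ≤ ∑ r, p r * d r by
    obtain ⟨d, h1, h2⟩ := h
    calc ∑ r, p r * collectTime s ε β (insert r S)
        ≤ ∑ r, p r * (collectTime s ε β S - d r) :=
          sum_le_sum fun r _ => mul_le_mul_of_nonneg_left (h1 r) (hp r)
      _ = collectTime s ε β S - ∑ r, p r * d r := by
          simp only [mul_sub, sum_sub_distrib, ← sum_mul, hp1, one_mul]
      _ ≤ _ := by linarith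
  have hsub : ∀ r, ((insert r S)ᶜ.erase s).card ≤ (Sᶜ.erase s).card := fun r =>
    card_le_card (erase_subset_erase _ (compl_subset_compl.2 (subset_insert _ _)))
  have hH : ∀ r, (harmonic ((insert r S)ᶜ.erase s).card : ℝ) / β ≤
      (harmonic (Sᶜ.erase s).card : ℝ) / β := fun r =>
    div_le_div_of_nonneg_right (harmonic_mono_real (hsub r)) hβ.le
  by_cases hsS : s ∈ S
  · have hcard : (Sᶜ.erase s).card = Sᶜ.card := by
      rw [erase_eq_of_notMem (by simpa using hsS)]
    have hpos : 0 < Sᶜ.card := by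
      rw [card_pos, nonempty_iff_ne_empty, Ne, compl_eq_empty_iff]
      exact hS
    obtain ⟨j, hj⟩ : ∃ j, Sᶜ.card = j + 1 := ⟨_, (Nat.succ_pred_eq_of_pos hpos).symm⟩
    refine ⟨fun r => if r ∈ Sᶜ then 1 / ((j : ℝ) + 1) / β else 0, fun r => ?_, ?_⟩
    · have h1 : s ∈ insert r S := mem_insert_of_mem hsS
      simp only [collectTime, if_pos hsS, if_pos h1, zero_add]
      split_ifs with hr
      · have h2 : ((insert r S)ᶜ.erase s).card = j := by
          rw [erase_eq_of_notMem (by simp [hsS]), compl_insert,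
            card_erase_of_mem hr, hj, Nat.add_sub_cancel]
        rw [h2, hcard, hj, harmonic_succ_real, add_div]
        linarith
      · linarith [hH r]
    · have : ∀ r ∈ (univ : Finset α), p r * (if r ∈ Sᶜ then 1 / ((j : ℝ) + 1) / β else 0) =
          if r ∈ Sᶜ then 1 / ((j : ℝ) + 1) else 0 := by
        intro r _
        split_ifs with hr
        · rw [hb r (by rintro rfl; simp [hsS] at hr)]
          field_simp
        · simp
      rw [sum_congr rfl this, ← sum_filter, sum_const, nsmul_eq_mul]
      have h3 : (univ.filter (· ∈ Sᶜ)).card = j + 1 := by rw [← hj]; congr 1; ext; simp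
      rw [h3]
      push_cast
      rw [mul_one_div_cancel (by positivity)]
  · refine ⟨fun r => if r = s then 1 / ε else 0, fun r => ?_, ?_⟩
    · simp only [collectTime, if_neg hsS]
      have := hH r
      by_cases hr : r = s
      · subst hr
        simp only [mem_insert_self, if_true]
        linarith
      · have : s ∉ insert r S := by simp [hsS, Ne.symm hr]
        simp only [if_neg this, if_neg hr]
        linarith
    · simp [hs, hε.ne']

theorem le_expect_segments (hε : 0 < ε) (hβ : 0 < β) (hs : p s = ε)
    (hb : ∀ r, r ≠ s → p r = β) (hp1 : ∑ a, p a = 1) (hα : 1 < Fintype.card α) (n : ℕ) :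
    n / collectTime s ε β ∅ - 1 ≤ expect p n (segments ∅) := by
  have hp : ∀ r, 0 ≤ p r := fun r => by
    by_cases h : r = s
    · rw [h, hs]; exact hε.le
    · rw [hb r h]; exact hβ.le
  have hR : 0 < collectTime s ε β ∅ := by
    have := div_nonneg (harmonic_nonneg (((∅ : Finset α)ᶜ).erase s).card) hβ.le
    have : 0 < 1 / ε := by positivity
    simp only [collectTime, notMem_empty, if_false]
    linarith
  have hR0 : ∀ S, 0 ≤ collectTime s ε β S := fun S => by
    have := div_nonneg (harmonic_nonneg ((Sᶜ).erase s).card) hβ.le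
    have : 0 < 1 / ε := by positivity
    simp only [collectTime]
    split_ifs <;> linarith
  have hU : collectTime s ε β univ = 0 := by simp [collectTime]
  have h := le_expect_of_potential hp hp1 segments (fun S r => if insert r S = univ then 1 else 0)
    (fun S r => if insert r S = univ then ∅ else insert r S) (fun _ _ _ => rfl)
    (fun S => S ≠ univ)
    (by
      intro S r _
      split_ifs with h
      · intro h0
        have := congrArg card h0
        rw [card_empty, card_univ] at this
        omega
      · exact h)
    (fun S => -(collectTime s ε β S / collectTime s ε β ∅)) (M := 0)
    (ρ := 1 / collectTime s ε β ∅) (fun S => by simpa using div_nonneg (hR0 S) hR.le)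
    (by
      intro S hS
      -- Completing a segment earns 1 and resets the potential from 0 to -1; these cancel, so the
      -- reset can be ignored.
      have h1 : ∀ r, ((if insert r S = univ then 1 else 0 : ℕ) : ℝ) +
          -(collectTime s ε β (if insert r S = univ then ∅ else insert r S) /
            collectTime s ε β ∅) =
          -(collectTime s ε β (insert r S) / collectTime s ε β ∅) := by
        intro r
        split_ifs with h
        · rw [h, hU, div_self hR.ne']
          simp
        · simp
      simp only [h1, mul_neg, sum_neg_distrib, ← mul_div_assoc, ← sum_div]
      rw [← neg_div, ← neg_div, ← add_div]
      refine div_le_div_of_nonneg_right ?_ hR.le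
      linarith [sum_mul_collectTime_insert_le hε hβ hs hb hp1 hS])
    n ∅ (by
      intro h0
      have := congrArg card h0
      rw [card_empty, card_univ] at this
      omega)
  rw [div_self hR.ne'] at h
  rw [mul_one_div] at h
  linarith

end

/-! ### One step of LRU and the position of the small page -/

/-- The cache of LRU after the request `r`. -/
def lruStep {α : Type*} [DecidableEq α] (k : ℕ) (L : List α) (r : α) : List α :=
  (r :: L.erase r).take k

theorem lru_cons {α : Type*} [DecidableEq α] (k : ℕ) (L : List α) (r : α) (σ : List α) :
    lru k L (r :: σ) =
      ((lruStep k L r).toFinset \ L.toFinset).card + lru k (lruStep k L r) σ := by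
  simp [lru, lruSchedule, Schedule.cost, lruStep]

theorem nodup_lruStep {α : Type*} [DecidableEq α] (k : ℕ) {L : List α} (hL : L.Nodup) (r : α) :
    (lruStep k L r).Nodup :=
  (List.nodup_cons.2 ⟨hL.not_mem_erase, hL.erase r⟩).sublist (List.take_sublist _ _)

theorem length_lruStep_le {α : Type*} [DecidableEq α] (k : ℕ) (L : List α) (r : α) :
    (lruStep k L r).length ≤ k :=
  List.length_take_le _ _

theorem one_le_card_lruStep_sdiff {α : Type*} [DecidableEq α] {k : ℕ} (hk : 1 ≤ k) {L : List α}
    {r : α} (hr : r ∉ L) : 1 ≤ ((lruStep k L r).toFinset \ L.toFinset).card := by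
  obtain ⟨k, rfl⟩ := Nat.exists_eq_add_of_le' hk
  rw [Nat.one_le_iff_ne_zero, Ne, card_eq_zero, ← Ne, ← nonempty_iff_ne_empty]
  exact ⟨r, by simp [lruStep, hr]⟩

/-- The number of pages in front of `s` in the list `L`, or `k` if `s` is missing. -/
def rank {α : Type*} [DecidableEq α] (k : ℕ) (s : α) (L : List α) : ℕ :=
  if s ∈ L then L.idxOf s else k

section

variable {α : Type*} [DecidableEq α] {k : ℕ} {s r : α} {A B : List α}

theorem rank_of_notMem {L : List α} (h : s ∉ L) : rank k s L = k := if_neg h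

theorem rank_append_cons (h : s ∉ A) : rank k s (A ++ s :: B) = A.length := by
  simp [rank, List.idxOf_append_of_notMem h]

theorem rank_lruStep_self (hk : 1 ≤ k) (L : List α) : rank k s (lruStep k L s) = 0 := by
  obtain ⟨k, rfl⟩ := Nat.exists_eq_add_of_le' hk
  simp [rank, lruStep]

theorem rank_lruStep_of_notMem {L : List α} (h : s ∉ L) (hr : r ≠ s) :
    rank k s (lruStep k L r) = k := by
  refine rank_of_notMem fun h' => ?_
  have := List.mem_of_mem_take h'
  rw [List.mem_cons] at this
  rcases this with h1 | h1
  · exact hr h1.symm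
  · exact h (List.mem_of_mem_erase h1)

theorem rank_lruStep_of_mem_front (h : s ∉ A) (hA : A.length < k) (hr : r ∈ A) :
    rank k s (lruStep k (A ++ s :: B) r) = A.length := by
  have h1 : (r :: A.erase r).length = A.length := by
    have := List.length_pos_of_mem hr
    rw [List.length_cons, List.length_erase_of_mem hr]
    omega
  have h2 : s ∉ r :: A.erase r := by
    rw [List.mem_cons, not_or]
    exact ⟨fun h0 => h (h0 ▸ hr), fun h0 => h (List.mem_of_mem_erase h0)⟩
  obtain ⟨j, hj⟩ : ∃ j, k - A.length = j + 1 := ⟨k - A.length - 1, by omega⟩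
  rw [lruStep, List.erase_append_left _ hr, ← List.cons_append, List.take_append,
    List.take_of_length_le (by omega), h1, hj, List.take_succ_cons, rank_append_cons h2, h1]

theorem rank_lruStep_of_notMem_front (h : s ∉ A) (hA : A.length < k) (hr : r ∉ A) (hrs : r ≠ s) :
    rank k s (lruStep k (A ++ s :: B) r) = A.length + 1 := by
  have h2 : s ∉ r :: A := by
    rw [List.mem_cons, not_or]
    exact ⟨hrs.symm, h⟩
  rw [lruStep, List.erase_append_right _ hr, List.erase_cons_tail (by simpa using hrs.symm),
    ← List.cons_append, List.take_append, List.take_of_length_le (by simpa using hA)]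
  rcases Nat.lt_or_ge (A.length + 1) k with hlt | hge
  · obtain ⟨j, hj⟩ : ∃ j, k - (r :: A).length = j + 1 :=
      ⟨k - (A.length + 1) - 1, by rw [List.length_cons]; omega⟩
    rw [hj, List.take_succ_cons, rank_append_cons h2, List.length_cons]
  -- Here `s` falls out of the cache; the value `k` for a missing page makes this an ordinary
  -- increase of the rank by one.
  · rw [List.length_cons, Nat.sub_eq_zero_of_le hge, List.take_zero, List.append_nil,
      rank_of_notMem h2]
    omega

end

/-! ### Lower bound on LRU by a harmonic potential -/

section

variable {α : Type*} [Fintype α] [DecidableEq α] {s : α} {p : α → ℝ} {ε β γ : ℝ} {k : ℕ}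

/-- With `s` cached, the missing big page costs `β` in expectation and the potential loses at most
`βγ`. With `s` missing the potential is 0, and its request, of probability `ε`, yields the fault
plus `γ H_k`; `hγ'` makes this suffice. -/
theorem lru_drift (hk : 1 ≤ k) (hα : Fintype.card α = k + 1) (hε : 0 < ε) (hβ : 0 < β)
    (hs : p s = ε) (hb : ∀ r, r ≠ s → p r = β) (hp1 : ∑ a, p a = 1) (hγ : 0 ≤ γ)
    (hγ' : β * (1 - γ) ≤ ε * (1 + γ * harmonic k)) {L : List α} (hL : L.Nodup)
    (hLk : L.length ≤ k) :
    γ * harmonic (k - rank k s L) + β * (1 - γ) ≤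
      ∑ r, p r * (((lruStep k L r).toFinset \ L.toFinset).card +
        γ * harmonic (k - rank k s (lruStep k L r))) := by
  have hp : ∀ r, 0 ≤ p r := fun r => by
    by_cases h : r = s
    · rw [h, hs]; exact hε.le
    · rw [hb r h]; exact hβ.le
  have hcost : ∀ r, (if r ∈ L then 0 else 1 : ℝ) ≤
      ((lruStep k L r).toFinset \ L.toFinset).card := by
    intro r
    split_ifs with h
    · positivity
    · exact_mod_cast one_le_card_lruStep_sdiff hk h
  have hΦ : ∀ j : ℕ, 0 ≤ γ * (harmonic j : ℝ) := fun j => mul_nonneg hγ (harmonic_nonneg j)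
  by_cases hsL : s ∈ L
  · obtain ⟨A, B, rfl, hsA⟩ := List.eq_append_cons_of_mem hsL
    obtain ⟨m, hm⟩ : ∃ m, m ∉ A ++ s :: B := by
      by_contra! hall
      have : (univ : Finset α) ⊆ (A ++ s :: B).toFinset := fun x _ => by
        rw [List.mem_toFinset]; exact hall x
      have := (card_le_card this).trans (List.toFinset_card_le _)
      rw [card_univ] at this
      omega
    have hms : m ≠ s := fun h => hm (h ▸ hsL)
    have hAk : A.length < k := by
      rw [List.length_append, List.length_cons] at hLk
      omega
    obtain ⟨j, hj⟩ : ∃ j, k - A.length = j + 1 := ⟨k - A.length - 1, by omega⟩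
    have hj' : k - (A.length + 1) = j := by omega
    -- The pages whose request pushes `s` one place back: those behind it and the missing one. Each
    -- lowers the potential by `γ/(j + 1)`, and there are `j + 1` of them, so the expected loss does
    -- not depend on the position.
    set S : Finset α := (insert s A.toFinset)ᶜ with hS
    have hScard : S.card = j + 1 := by
      rw [hS, card_compl, card_insert_of_notMem (by simpa using hsA),
        List.toFinset_card_of_nodup (hL.sublist (List.sublist_append_left _ _)), hα]
      omega
    rw [rank_append_cons hsA, hj]
    have hterm : ∀ r, γ * (harmonic (j + 1) : ℝ) + (if r = m then 1 else 0) -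
        (if r ∈ S then γ / ((j : ℝ) + 1) else 0) ≤
        (((lruStep k (A ++ s :: B) r).toFinset \ (A ++ s :: B).toFinset).card +
        γ * harmonic (k - rank k s (lruStep k (A ++ s :: B) r)) : ℝ) := by
      intro r
      have h1 : (if r = m then 1 else 0 : ℝ) ≤
          ((lruStep k (A ++ s :: B) r).toFinset \ (A ++ s :: B).toFinset).card := by
        refine le_trans ?_ (hcost r)
        by_cases hrm : r = m
        · rw [if_pos hrm, if_neg (hrm ▸ hm)]
        · rw [if_neg hrm]; split_ifs <;> norm_num
      have h2 : γ * (harmonic (j + 1) : ℝ) - (if r ∈ S then γ / ((j : ℝ) + 1) else 0) ≤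
          γ * harmonic (k - rank k s (lruStep k (A ++ s :: B) r)) := by
        by_cases hrs : r = s
        · subst hrs
          have hrS : r ∉ S := by simp [hS]
          rw [if_neg hrS, sub_zero, rank_lruStep_self hk, ← hj]
          exact mul_le_mul_of_nonneg_left (harmonic_mono_real (by omega)) hγ
        by_cases hrA : r ∈ A
        · have hrS : r ∉ S := by simp [hS, hrA]
          rw [if_neg hrS, rank_lruStep_of_mem_front hsA hAk hrA, hj, sub_zero]
        · have hrS : r ∈ S := by simp [hS, hrA, hrs]
          rw [if_pos hrS, rank_lruStep_of_notMem_front hsA hAk hrA hrs, hj', harmonic_succ_real,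
            mul_add, mul_one_div, add_sub_cancel_right]
      linarith
    refine le_trans (le_of_eq ?_) (sum_le_sum fun r _ => mul_le_mul_of_nonneg_left (hterm r) (hp r))
    simp only [mul_sub, mul_add, sum_sub_distrib, sum_add_distrib, ← sum_mul, hp1, one_mul]
    have h3 : ∑ r, p r * (if r = m then 1 else 0) = β := by simp [hb m hms]
    have h4 : ∑ r, p r * (if r ∈ S then γ / ((j : ℝ) + 1) else 0) = β * γ := by
      simp only [mul_ite, mul_zero, sum_ite_mem, univ_inter]
      rw [sum_congr rfl fun r hr => by
        rw [hb r (by rintro rfl; simp [hS] at hr)], sum_const, hScard, nsmul_eq_mul]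
      push_cast
      field_simp
    rw [h3, h4]
    ring
  · rw [rank_of_notMem hsL]
    have h1 : p s * (1 + γ * harmonic k) ≤ ∑ r, p r *
        (((lruStep k L r).toFinset \ L.toFinset).card +
        γ * harmonic (k - rank k s (lruStep k L r))) := by
      refine le_trans ?_ (single_le_sum (fun r _ => mul_nonneg (hp r)
        (add_nonneg (Nat.cast_nonneg _) (hΦ _))) (mem_univ s))
      refine mul_le_mul_of_nonneg_left ?_ (hp s)
      have := hcost s
      rw [if_neg hsL] at this
      rw [rank_lruStep_self hk, Nat.sub_zero]
      linarith
    rw [hs] at h1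
    simp only [Nat.sub_self, harmonic_zero, Rat.cast_zero, mul_zero]
    linarith

theorem le_expect_lru (hk : 1 ≤ k) (hα : Fintype.card α = k + 1) (hε : 0 < ε) (hβ : 0 < β)
    (hs : p s = ε) (hb : ∀ r, r ≠ s → p r = β) (hp1 : ∑ a, p a = 1) (hγ : 0 ≤ γ)
    (hγ' : β * (1 - γ) ≤ ε * (1 + γ * harmonic k)) {L : List α} (hL : L.Nodup)
    (hLk : L.length ≤ k) (n : ℕ) :
    n * (β * (1 - γ)) - γ * harmonic k ≤ expect p n (lru k L) := by
  have hp : ∀ r, 0 ≤ p r := fun r => by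
    by_cases h : r = s
    · rw [h, hs]; exact hε.le
    · rw [hb r h]; exact hβ.le
  have h := le_expect_of_potential hp hp1 (lru k)
    (fun L r => ((lruStep k L r).toFinset \ L.toFinset).card) (lruStep k) (lru_cons k)
    (fun L => L.Nodup ∧ L.length ≤ k)
    (fun L r h => ⟨nodup_lruStep k h.1 r, length_lruStep_le k L r⟩)
    (fun L => γ * harmonic (k - rank k s L)) (M := γ * harmonic k) (ρ := β * (1 - γ))
    (fun L => mul_le_mul_of_nonneg_left (harmonic_mono_real (Nat.sub_le _ _)) hγ)
    (fun L h => lru_drift hk hα hε hβ hs hb hp1 hγ hγ' h.1 h.2) n L ⟨hL, hLk⟩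
  have : 0 ≤ γ * (harmonic (k - rank k s L) : ℝ) := mul_nonneg hγ (harmonic_nonneg _)
  linarith

end

/-! ### Upper bound on PLFU -/

/-- Triangle inequality for caches; it reduces PLFU to the initial cache `T`, at a bounded extra
cost that vanishes in the limit. -/
theorem Schedule.cost_le_card_sdiff_add {α : Type*} [DecidableEq α] (C T : Finset α)
    (s : Schedule α) : s.cost C ≤ (T \ C).card + s.cost T := by
  cases s with
  | nil => simp [Schedule.cost]
  | cons DE s =>
    obtain ⟨D, E⟩ := DE
    simp only [Schedule.cost]
    have : (D \ C).card ≤ (D \ T).card + (T \ C).card := by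
      refine le_trans (card_le_card fun x hx => ?_) (card_union_le _ _)
      simp only [mem_sdiff, mem_union] at hx ⊢
      tauto
    omega

theorem plfu_cons_self {α : Type*} [DecidableEq α] {T : Finset α} {w : α} (hw : w ∈ T) (r : α)
    (σ : List α) : plfu T w T (r :: σ) = (if r ∈ T then 0 else 2) + plfu T w T σ := by
  unfold plfu plfuSchedule
  rw [List.map_cons]
  by_cases hr : r ∈ T
  · simp [hr, Schedule.cost]
  · simp only [hr, if_false, Schedule.cost]
    have h1 : insert r (T.erase w) \ T = {r} := by
      ext x
      simp only [mem_sdiff, mem_insert, mem_erase, mem_singleton]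
      constructor
      · tauto
      · rintro rfl
        exact ⟨Or.inl rfl, hr⟩
    have h2 : T \ insert r (T.erase w) = {w} := by
      ext x
      simp only [mem_sdiff, mem_insert, mem_erase, mem_singleton]
      constructor
      · tauto
      · rintro rfl
        refine ⟨hw, ?_⟩
        rintro (rfl | h)
        · exact hr hw
        · exact h.1 rfl
    rw [h1, h2]
    simp

theorem expect_plfu_le {α : Type*} [Fintype α] [DecidableEq α] {p : α → ℝ} {k : ℕ}
    (hp : ∀ a, 0 ≤ p a) (hp1 : ∑ a, p a = 1) {T : Finset α} {w : α} (hT : IsMostPopular p k T w)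
    (C : Finset α) (n : ℕ) : expect p n (plfu T w C) ≤ k + n * (2 * ∑ r ∈ Tᶜ, p r) := by
  have h1 : expect p n (plfu T w T) = n * (2 * ∑ r ∈ Tᶜ, p r) := by
    induction n with
    | zero => simp [expect_zero, plfu, plfuSchedule, Schedule.cost]
    | succ n ih =>
      simp only [expect_succ, plfu_cons_self hT.mem, expect_const_add hp1, ih, mul_add,
        sum_add_distrib, ← sum_mul, hp1]
      have : ∑ r, p r * ((if r ∈ T then 0 else 2 : ℕ) : ℝ) = 2 * ∑ r ∈ Tᶜ, p r := by
        rw [mul_sum, ← sum_subset (subset_univ Tᶜ)]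
        · refine sum_congr rfl fun r hr => ?_
          rw [if_neg (by simpa using hr)]
          push_cast
          ring
        · intro r _ hr
          rw [if_pos (by simpa using hr)]
          simp
      rw [this]
      push_cast
      ring
  have h2 := expect_mono (n := n) hp (f := plfu T w C) (g := fun σ => k + plfu T w T σ) fun σ => by
    refine (Schedule.cost_le_card_sdiff_add C T _).trans (Nat.add_le_add_right ?_ _)
    exact (card_le_card sdiff_subset).trans hT.card_eq.le
  rw [expect_const_add hp1, h1] at h2
  exact h2

/-- Ties occur only among big pages, so however they are broken the small page is the one left out.
-/
theorem IsMostPopular.compl_eq {k : ℕ} (hk : 2 ≤ k) {T : Finset (Fin (k + 1))} {w : Fin (k + 1)}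
    (hT : IsMostPopular (prob k) k T w) : Tᶜ = {Fin.last k} := by
  have hlt := (small_lt_big hk).2
  have hcard : Tᶜ.card = 1 := by
    rw [card_compl, hT.card_eq, Fintype.card_fin]
    omega
  obtain ⟨j, hj⟩ := card_eq_one.1 hcard
  have hjT : j ∉ T := by rw [← mem_compl, hj, mem_singleton]
  rw [hj, singleton_inj]
  by_contra hne
  have hl : Fin.last k ∈ T := by
    by_contra h
    rw [← mem_compl, hj, mem_singleton] at h
    exact hne h.symm
  have := (hT.le_of_notMem j hjT).trans (hT.le_of_mem _ hl)
  simp only [prob, if_neg hne, if_true] at this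
  linarith

/-! ### The instance: affine bounds in `n` and ratios of their slopes -/

open Filter Topology

theorem tendsto_affine_div_affine (a b a' : ℝ) {b' : ℝ} (hb' : b' ≠ 0) :
    Tendsto (fun n : ℕ => (a + n * b) / (a' + n * b')) atTop (𝓝 (b / b')) := by
  have h : ∀ x y : ℝ, Tendsto (fun n : ℕ => x / (n : ℝ) + y) atTop (𝓝 y) := fun x y => by
    simpa using (tendsto_const_div_atTop_nhds_zero_nat x).add_const y
  refine ((h a b).div (h a' b') hb').congr' ?_
  filter_upwards [eventually_gt_atTop 0] with n hn
  have hn' : (n : ℝ) ≠ 0 := by positivity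
  simp only [Pi.div_apply]
  rw [div_add' _ _ _ hn', div_add' _ _ _ hn', div_div_div_cancel_right₀ hn', mul_comm b,
    mul_comm b']

section

variable {k : ℕ} {C : Finset (Fin (k + 1))}

theorem le_expect_opt (hk : 2 ≤ k) (hC : C.card ≤ k) (n : ℕ) :
    -1 + n * (1 / collectTime (Fin.last k) (prob k (Fin.last k)) (prob k 0) ∅) ≤
      expect (prob k) n (opt k C) := by
  obtain ⟨T, w, hT⟩ := exists_isMostPopular hk
  have h0 : (0 : Fin (k + 1)) ≠ Fin.last k := by
    rw [Ne, Fin.ext_iff, Fin.val_zero, Fin.val_last]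
    omega
  have h1 := le_expect_segments (n := n) (prob_pos hk (Fin.last k)) (prob_pos hk 0) rfl
    (fun r hr => by simp [prob, hr, h0]) (sum_prob (by omega)) (by simp; omega)
  have h2 := expect_mono (n := n) (fun a => (prob_pos hk a).le) fun σ =>
    segments_le_opt (by simp) hC ⟨_, plfuSchedule_serves hT σ⟩
  rw [mul_one_div]
  linarith

theorem expect_plfu_prob_le (hk : 2 ≤ k) {T : Finset (Fin (k + 1))} {w : Fin (k + 1)}
    (hT : IsMostPopular (prob k) k T w) (n : ℕ) :
    expect (prob k) n (plfu T w C) ≤ k + n * (2 * prob k (Fin.last k)) := by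
  have h := expect_plfu_le (fun a => (prob_pos hk a).le) (sum_prob (by omega)) hT C n
  rwa [hT.compl_eq hk, sum_singleton] at h

theorem expect_opt_le (hk : 2 ≤ k) (n : ℕ) :
    expect (prob k) n (opt k C) ≤ k + n * (2 * prob k (Fin.last k)) := by
  obtain ⟨T, w, hT⟩ := exists_isMostPopular hk
  exact (expect_mono (fun a => (prob_pos hk a).le) n fun σ =>
    opt_le_cost C (plfuSchedule_serves hT σ)).trans (expect_plfu_prob_le hk hT n)

theorem prob_last (k : ℕ) : prob k (Fin.last k) = 1 / (k : ℝ) ^ 3 := if_pos rfl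

theorem prob_zero (hk : 2 ≤ k) : prob k 0 = (1 - 1 / (k : ℝ) ^ 3) / k := by
  refine if_neg fun h => ?_
  rw [Fin.ext_iff, Fin.val_zero, Fin.val_last] at h
  omega

theorem collectTime_empty (s : Fin (k + 1)) (ε β : ℝ) :
    collectTime s ε β ∅ = 1 / ε + harmonic k / β := by
  simp [collectTime]

theorem le_expect_lru_prob (hk : 2 ≤ k) {L : List (Fin (k + 1))} (hL : L.Nodup)
    (hLk : L.length ≤ k) : ∃ M : ℝ, ∀ n : ℕ,
    -M + n * (prob k (Fin.last k) * harmonic (k - 1)) ≤ expect (prob k) n (lru k L) := by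
  have hk' : (2 : ℝ) ≤ k := by exact_mod_cast hk
  have hβ := prob_pos hk 0
  have hε := prob_pos hk (Fin.last k)
  have h0 : (0 : Fin (k + 1)) ≠ Fin.last k := by
    rw [Ne, Fin.ext_iff, Fin.val_zero, Fin.val_last]
    omega
  have hH := harmonic_le_self k
  have hH0 := harmonic_nonneg k
  have hH0' := harmonic_nonneg (k - 1)
  have hsucc : (harmonic k : ℝ) = harmonic (k - 1) + 1 / k := by
    have h := harmonic_succ_real (k - 1)
    rw [Nat.sub_add_cancel (by omega)] at h
    rw [h]
    congr 2
    exact_mod_cast Nat.sub_add_cancel (by omega : 1 ≤ k)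
  have hH' : (harmonic (k - 1) : ℝ) ≤ k - 1 := by
    have := harmonic_le_self (k - 1)
    rwa [Nat.cast_sub (by omega), Nat.cast_one] at this
  have hq : prob k (Fin.last k) / prob k 0 = k / ((k : ℝ) ^ 3 - 1) := by
    have : (k : ℝ) ^ 3 - 1 ≠ 0 := by nlinarith [mul_self_nonneg (k : ℝ)]
    rw [prob_last, prob_zero hk]
    field_simp
  have hk3 : 0 < (k : ℝ) ^ 3 - 1 := by nlinarith [mul_self_nonneg (k : ℝ)]
  set q := prob k (Fin.last k) / prob k 0 with hq0
  have hεq : prob k (Fin.last k) = prob k 0 * q := by rw [hq0]; field_simp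
  have hqpos : 0 < q := by positivity
  -- By `H_{k-1} ≤ k - 1`, the left side is at most `(k^3 - k^2)/(k^3 - 1)`.
  have hqH : q * (harmonic (k - 1) * k) ≤ 1 := by
    rw [hq, div_mul_eq_mul_div, div_le_one hk3]
    calc (k : ℝ) * (harmonic (k - 1) * k) ≤ k * ((k - 1) * k) := by gcongr
      _ ≤ _ := by nlinarith
  have hqH1 : q * harmonic (k - 1) ≤ 1 := by
    refine le_trans ?_ hqH
    have : (harmonic (k - 1) : ℝ) ≤ harmonic (k - 1) * k :=
      le_mul_of_one_le_right hH0' (by linarith)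
    gcongr
  refine ⟨(1 - q * harmonic (k - 1)) * harmonic k, fun n => ?_⟩
  -- This `γ` turns the rate `β(1 - γ)` into exactly `ε H_{k-1}`. The balance condition becomes
  -- `H_{k-1} ≤ 1 + H_k - q H_{k-1} H_k`, which follows from `q H_{k-1} H_k ≤ 1`.
  have h := le_expect_lru (s := Fin.last k) (p := prob k) (γ := 1 - q * harmonic (k - 1))
    (by omega : 1 ≤ k) (by simp) hε hβ rfl (fun r hr => by simp [prob, hr, h0])
    (sum_prob (by omega)) (by linarith)
    (by
      have h1 : q * harmonic (k - 1) * harmonic k ≤ 1 := by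
        refine le_trans ?_ hqH
        rw [mul_assoc]
        gcongr
      have h2 : 0 < 1 / (k : ℝ) := by positivity
      calc prob k 0 * (1 - (1 - q * harmonic (k - 1)))
          = prob k (Fin.last k) * harmonic (k - 1) := by rw [hεq]; ring
        _ ≤ _ := by
          refine mul_le_mul_of_nonneg_left ?_ hε.le
          have : (1 - q * harmonic (k - 1)) * (harmonic k : ℝ) =
            harmonic k - q * harmonic (k - 1) * harmonic k := by ring
          linarith) hL hLk n
  rw [hεq]
  have : prob k 0 * (1 - (1 - q * harmonic (k - 1))) = prob k 0 * q * harmonic (k - 1) := by ring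
  rw [this] at h
  linarith

theorem collectTime_pos (hk : 2 ≤ k) :
    0 < collectTime (Fin.last k) (prob k (Fin.last k)) (prob k 0) ∅ := by
  have h1 := prob_pos hk 0
  have h2 := prob_pos hk (Fin.last k)
  have h3 := harmonic_nonneg k
  rw [collectTime_empty]
  positivity

theorem eventually_pos_affine (a : ℝ) {b : ℝ} (hb : 0 < b) : ∀ᶠ n : ℕ in atTop, 0 < a + n * b := by
  have : Tendsto (fun n : ℕ => a + n * b) atTop atTop :=
    tendsto_atTop_add_const_left _ _ (tendsto_natCast_atTop_atTop.atTop_mul_const hb)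
  exact this.eventually_gt_atTop 0

theorem half_harmonic_le_RoE_lru (hk : 2 ≤ k) {L : List (Fin (k + 1))} (hL : L.Nodup)
    (hLk : L.length ≤ k) :
    (((harmonic (k - 1) : ℚ) : ℝ) / 2 : ℝ) ≤ RoE (prob k) k L.toFinset (lru k L) := by
  have hε := prob_pos hk (Fin.last k)
  obtain ⟨M, hM⟩ := le_expect_lru_prob hk hL hLk
  have hlim := tendsto_affine_div_affine (-M) (prob k (Fin.last k) * harmonic (k - 1)) k
    (b' := 2 * prob k (Fin.last k)) (by positivity)
  have heq : prob k (Fin.last k) * harmonic (k - 1) / (2 * prob k (Fin.last k)) =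
      (harmonic (k - 1) : ℝ) / 2 := by field_simp
  rw [heq] at hlim
  rw [← ((continuous_coe_real_ereal.tendsto _).comp hlim).limsup_eq]
  refine limsup_le_limsup ?_
  -- The lower bound on OPT serves here only to keep the denominator positive.
  filter_upwards [eventually_pos_affine (-1) (one_div_pos.2 (collectTime_pos hk))] with n hn
  have hopt := le_expect_opt hk ((List.toFinset_card_le L).trans hLk) n
  exact EReal.coe_le_coe_iff.2 (div_le_div₀ (expect_nonneg (fun a => (prob_pos hk a).le) _ _)
    (hM n) (hn.trans_le hopt) (expect_opt_le hk n))

theorem RoE_plfu_lt_four (hk : 2 ≤ k) (hC : C.card ≤ k) {T : Finset (Fin (k + 1))}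
    {w : Fin (k + 1)} (hT : IsMostPopular (prob k) k T w) :
    RoE (prob k) k C (plfu T w C) < 4 := by
  have hε := prob_pos hk (Fin.last k)
  have hR := collectTime_pos hk
  have hlim := tendsto_affine_div_affine k (2 * prob k (Fin.last k)) (-1)
    (one_div_pos.2 hR).ne'
  have hle : RoE (prob k) k C (plfu T w C) ≤ ((2 * prob k (Fin.last k) /
      (1 / collectTime (Fin.last k) (prob k (Fin.last k)) (prob k 0) ∅) : ℝ) : EReal) := by
    rw [← ((continuous_coe_real_ereal.tendsto _).comp hlim).limsup_eq]
    refine limsup_le_limsup ?_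
    filter_upwards [eventually_pos_affine (-1) (one_div_pos.2 hR)] with n hn
    exact EReal.coe_le_coe_iff.2 (div_le_div₀ (by positivity) (expect_plfu_prob_le hk hT n) hn
      (le_expect_opt hk hC n))
  refine hle.trans_lt ?_
  have h4 : (4 : EReal) = ((4 : ℝ) : EReal) := rfl
  rw [h4, EReal.coe_lt_coe_iff, div_div_eq_mul_div, div_one, collectTime_empty]
  have hk' : (2 : ℝ) ≤ k := by exact_mod_cast hk
  have hk3 : 0 < (k : ℝ) ^ 3 - 1 := by nlinarith [mul_self_nonneg (k : ℝ)]
  have h1 : 2 * prob k (Fin.last k) * (1 / prob k (Fin.last k) + harmonic k / prob k 0) =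
      2 + 2 * (k * harmonic k / ((k : ℝ) ^ 3 - 1)) := by
    rw [prob_last, prob_zero hk]
    field_simp
  have h2 : (k : ℝ) * harmonic k / ((k : ℝ) ^ 3 - 1) < 1 := by
    rw [div_lt_one hk3]
    calc (k : ℝ) * harmonic k ≤ k * k := by
          have := harmonic_le_self k
          gcongr
      _ < _ := by nlinarith
  linarith

end

theorem log_le_harmonic_pred {k : ℕ} (hk : 1 ≤ k) : Real.log k ≤ harmonic (k - 1) := by
  have h := log_add_one_le_harmonic (k - 1)
  rwa [Nat.sub_add_cancel hk] at h

end Paging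

theorem mainTheorem11 :
    ∃ c : ℝ, 0 < c ∧ ∀ k : ℕ, 2 ≤ k →
      ∀ L : List (Fin (k + 1)), L.Nodup → L.length ≤ k →
        ((c * Real.log k : ℝ) : EReal) ≤
            Paging.RoE (Paging.prob k) k L.toFinset (Paging.lru k L) ∧
        ((((harmonic (k - 1) : ℚ) : ℝ) / 2 : ℝ) : EReal) ≤
            Paging.RoE (Paging.prob k) k L.toFinset (Paging.lru k L) ∧
        ∀ (T : Finset (Fin (k + 1))) (w : Fin (k + 1)),
          Paging.IsMostPopular (Paging.prob k) k T w →
            Paging.RoE (Paging.prob k) k L.toFinset (Paging.plfu T w L.toFinset) < 4 ∧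
            ((c * Real.log k : ℝ) : EReal) *
                Paging.RoE (Paging.prob k) k L.toFinset (Paging.plfu T w L.toFinset) ≤
              Paging.RoE (Paging.prob k) k L.toFinset (Paging.lru k L) := by
  -- The factor `1/2` of the LRU bound divided by the PLFU bound 4, with `log k ≤ H_{k-1}`.
  refine ⟨1 / 8, by norm_num, fun k hk L hL hLk => ?_⟩
  have hlru := Paging.half_harmonic_le_RoE_lru hk hL hLk
  have hlog := Paging.log_le_harmonic_pred (by omega : 1 ≤ k)
  have hlog0 : 0 ≤ Real.log k := Real.log_natCast_nonneg k
  refine ⟨le_trans (EReal.coe_le_coe_iff.2 (by linarith)) hlru, hlru, fun T w hT => ?_⟩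
  have hlt := Paging.RoE_plfu_lt_four hk ((List.toFinset_card_le L).trans hLk) hT
  refine ⟨hlt, (mul_le_mul_of_nonneg_left hlt.le (EReal.coe_nonneg.2 (by positivity))).trans
    (le_trans ?_ hlru)⟩
  have h4 : (4 : EReal) = ((4 : ℝ) : EReal) := rfl
  rw [h4, ← EReal.coe_mul]
  exact EReal.coe_le_coe_iff.2 (by linarith)
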